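/- Let $\Phi_0$ be an irreducible reduced crystallographic finite root system with simple roots $\mathcal D_0$ and highest root $\theta_0$, and let $\mathcal D=\mathcal D_0\sqcup\{\alpha_0\}$ be the vertex set of the extended Dynkin diagram, whose Cartan matrix $(\langle\alpha_i^\vee,\alpha_j\rangle)_{\alpha_i,\alpha_j\in\mathcal D}$ is obtained by letting $\alpha_0$ pair as $-\theta_0$ and $\alpha_0^\vee$ as $-\theta_0^\vee$. Let $V$ be the real vector space with basis $\mathcal D$, let $W\subset GL(V)$ be the Weyl group generated by the simple reflections $s_\alpha(x)=x-\alpha^\vee(x)\alpha$, $\alpha\in\mathcal D$, and put $\delta=\alpha_0+\theta_0\in V$. Let $\alpha_d\in\mathcal D_0$ be a cominuscule simple root, i.e. the coefficient of $\alpha_d$ in $\delta$ is $1$; put $\mathcal J=\mathcal D_0\setminus\{\alpha_d\}$ and let $w_{\mathcal J}$ be the longest element of the subgroup $W_{\mathcal J}$ generated by the $s_\alpha$, $\alpha\in\mathcal J$. Let $\iota:V\to V$ be the linear map with $$\iota(\alpha_0)=\alpha_d,\qquad \iota(\alpha_d)=\alpha_0,\qquad \iota(\alpha)=-w_{\mathcal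 J}(\alpha)\quad(\alpha\in\mathcal J).$$ Then $\iota^2=\mathrm{id}_V$, and $\iota$ induces an involution of the extended Dynkin diagram: it permutes the set $\mathcal D$ of simple roots, and this permutation is an involution that preserves the Cartan matrix, $\langle\iota(\alpha)^\vee,\iota(\beta)\rangle=\langle\alpha^\vee,\beta\rangle$ for all $\alpha,\beta\in\mathcal D$. Moreover, every $W$-invariant symmetric bilinear form $(\cdot\,|\,\cdot)$ on $V$ with $s_\alpha(\beta)=\beta-2\frac{(\alpha|\beta)}{(\alpha|\alpha)}\alpha$ for all $\alpha\in\mathcal D$, $\beta\in V$ satisfies $(\iota(x)\,|\,\iota(y))=(x\,|\,y)$ for all $x,y\in V$. -/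

import Mathlib

noncomputable section

namespace ExtDynkin

variable {I M N : Type*} [AddCommGroup M] [Module ℝ M] [AddCommGroup N] [Module ℝ N]
  {P : RootPairing I ℝ M N} (b : P.Base)

/-- The root with index `t` is the highest root: it exceeds every root by a sum of
simple roots. -/
def IsHighestRoot (t : I) : Prop :=
  ∀ i, P.root t - P.root i ∈ AddSubmonoid.closure (P.root '' b.support)

/-- The (index of the) highest root `θ₀`; it exists and is unique when the root system is
finite, crystallographic, reduced and irreducible. -/
def highestRoot [Nonempty I] : I :=
  Classical.epsilon (IsHighestRoot b)

/-- The vertices of the extended Dynkin diagram `D`: the vertices `some i` of `D₀`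
together with the extra vertex `none`, which stands for `α₀`. -/
abbrev Node : Type _ := Option b.support

/-- The finite root attached to a vertex of `D`: the simple root itself for a vertex of `D₀`,
and `-θ₀` for the extra vertex. -/
def finiteRoot [Nonempty I] : Node b → I
  | none => P.reflectionPerm (highestRoot b) (highestRoot b)
  | some i => i

/-- The Cartan matrix `⟨αᵢ^∨, αⱼ⟩` of the extended Dynkin diagram. The diagram and its Cartan
matrix determine each other, so that an automorphism of the diagram is a permutation of the
vertices that preserves this matrix. -/
def cartan [Nonempty I] [P.IsCrystallographic] (i j : Node b) : ℤ :=
  P.pairingIn ℤ (finiteRoot b j) (finiteRoot b i)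

theorem cartan_self [Nonempty I] [P.IsCrystallographic] (i : Node b) : cartan b i i = 2 := by
  simp [cartan]

/-- The real vector space `V` with basis `D`. -/
abbrev V : Type _ := Node b →₀ ℝ

/-- The simple root `αᵢ`, an element of the basis `D` of `V`. -/
def simpleRoot (i : Node b) : V b := Finsupp.single i 1

/-- The simple coroot `αᵢ^∨` as a linear form on `V`. -/
def simpleCoroot [Nonempty I] [P.IsCrystallographic] (i : Node b) : V b →ₗ[ℝ] ℝ :=
  Finsupp.linearCombination ℝ fun j => (cartan b i j : ℝ)

theorem simpleCoroot_simpleRoot_self [Nonempty I] [P.IsCrystallographic] (i : Node b) :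
    simpleCoroot b i (simpleRoot b i) = 2 := by
  simp [simpleCoroot, simpleRoot, cartan_self]

/-- The simple reflection `sᵢ(x) = x - αᵢ^∨(x) αᵢ` of `V`. -/
def simpleReflection [Nonempty I] [P.IsCrystallographic] (i : Node b) : V b ≃ₗ[ℝ] V b :=
  Module.reflection (simpleCoroot_simpleRoot_self b i)

/-- The subgroup `W_J` of the Weyl group generated by the simple reflections in `J`. The Weyl
group `W` itself is the case `J = D`. -/
def weylSubgroup [Nonempty I] [P.IsCrystallographic] (J : Set (Node b)) :
    Subgroup (V b ≃ₗ[ℝ] V b) :=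
  Subgroup.closure (simpleReflection b '' J)

/-- The length of an element of `W_J`: the least number of factors in an expression as a
product of simple reflections in `J`. -/
def length [Nonempty I] [P.IsCrystallographic] (J : Set (Node b)) (w : V b ≃ₗ[ℝ] V b) : ℕ :=
  sInf {n | ∃ l : List (Node b), (∀ i ∈ l, i ∈ J) ∧ (l.map (simpleReflection b)).prod = w ∧
    l.length = n}

/-- `w` is an element of greatest length of `W_J`. -/
def IsLongest [Nonempty I] [P.IsCrystallographic] (J : Set (Node b)) (w : V b ≃ₗ[ℝ] V b) :
    Prop :=
  w ∈ weylSubgroup b J ∧ ∀ v ∈ weylSubgroup b J, length b J v ≤ length b J w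

/-- The longest element `w_J` of `W_J`; it exists and is unique when `W_J` is finite, that is,
for every proper subset `J` of `D`. -/
def longest [Nonempty I] [P.IsCrystallographic] (J : Set (Node b)) : V b ≃ₗ[ℝ] V b :=
  Classical.epsilon (IsLongest b J)

/-- The basic imaginary root `δ = α₀ + θ₀`, with `θ₀` expanded in the simple roots of `D₀`. -/
def delta [Nonempty I] [P.IsRootSystem] : V b :=
  simpleRoot b none +
    ∑ i : b.support, b.toWeightBasis.repr (P.root (highestRoot b)) i • simpleRoot b (some i)

/-- The simple root `α_d` of `D₀` is cominuscule: its coefficient in `δ` is `1`. -/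
def IsCominuscule [Nonempty I] [P.IsRootSystem] (d : b.support) : Prop :=
  delta b (some d) = 1

/-- The set `J = D₀ \ {α_d}`. -/
def setJ (d : b.support) : Set (Node b) := {x | ∃ i : b.support, i ≠ d ∧ x = some i}

open Classical in
/-- The linear map of `V` with `α₀ ↦ α_d`, `α_d ↦ α₀`, and `α ↦ -w_J(α)` for `α ∈ J`. -/
def iota [Nonempty I] [P.IsCrystallographic] (d : b.support) : V b →ₗ[ℝ] V b :=
  Finsupp.linearCombination ℝ fun x : Node b =>
    match x with
    | none => simpleRoot b (some d)
    | some i =>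
      if i = d then simpleRoot b none
      else -(longest b (setJ b d) (simpleRoot b (some i)))

/-- A `W`-invariant symmetric bilinear form on `V` with
`s_α(β) = β - 2 (α|β)/(α|α) α` for all simple roots `α` and all `β`. At `β = α` this
forces `(α|α) ≠ 0`. -/
structure IsInvariantForm [Nonempty I] [P.IsCrystallographic]
    (B : V b →ₗ[ℝ] V b →ₗ[ℝ] ℝ) : Prop where
  symm : ∀ x y, B x y = B y x
  invariant : ∀ w ∈ weylSubgroup b Set.univ, ∀ x y, B (w x) (w y) = B x y
  reflection : ∀ i x, simpleReflection b i x =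
    x - (2 * B (simpleRoot b i) x / B (simpleRoot b i) (simpleRoot b i)) • simpleRoot b i

end ExtDynkin

end

/-! Write `w` for the longest element of `W_J`. Everything follows from the formula `ι(x) = c(x) δ -
w(x)`, where `c` is `levelForm` (`iota_apply`). Checking it on simple roots requires `w(α_d) = θ₀`
and `w(θ₀) = α_d`.

By the exchange condition, `w` negates the simple roots of `J`, and then `w² = 1`. It also preserves
the `α_d`-coefficient. Building a positive root from simple roots therefore bounds the height of its
image under `w` when that coefficient is `0` or `1` (`height_wordPerm_le`). With coefficient `0`,
the bound forces `-w` to permute the simple roots of `J`. With coefficient `1`, which is the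
cominuscule hypothesis for `θ₀`, maximality of the height of `θ₀` forces `w(α_d) = θ₀`.

Modulo `δ`, `ι` is `-w`, so it permutes the finite roots attached to the vertices and preserves
their pairings. An invariant form has `δ` in its radical, so it sees only `w`, under which it is
invariant. -/

noncomputable section

namespace ExtDynkin

/-! ### Words in the finite simple reflections and the exchange condition -/

section Words

variable {I M N : Type*} [AddCommGroup M] [Module ℝ M] [AddCommGroup N] [Module ℝ N]
  {P : RootPairing I ℝ M N} (b : P.Base)

/-- The permutation of the roots induced by a word in the simple reflections. -/
def wordPerm (l : List b.support) : Equiv.Perm I :=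
  (l.map fun i => P.reflectionPerm i).prod

/-- The linear automorphism of the weight space induced by a word in the simple reflections. -/
def wordEquiv (l : List b.support) : M ≃ₗ[ℝ] M :=
  (l.map fun i => P.reflection i).prod

@[simp] theorem wordPerm_nil : wordPerm b [] = 1 := rfl

@[simp] theorem wordPerm_cons (i : b.support) (l : List b.support) :
    wordPerm b (i :: l) = P.reflectionPerm i * wordPerm b l := by
  simp [wordPerm]

@[simp] theorem wordPerm_append (l m : List b.support) :
    wordPerm b (l ++ m) = wordPerm b l * wordPerm b m := by
  simp [wordPerm]

@[simp] theorem wordEquiv_cons (i : b.support) (l : List b.support) :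
    wordEquiv b (i :: l) = P.reflection i * wordEquiv b l := by
  simp [wordEquiv]

theorem wordPerm_reverse (l : List b.support) :
    wordPerm b l.reverse = (wordPerm b l)⁻¹ := by
  induction l with
  | nil => simp
  | cons i l ih => simp [ih]

theorem wordPerm_wordPerm_reverse (l : List b.support) (i : I) :
    wordPerm b l (wordPerm b l.reverse i) = i := by
  rw [wordPerm_reverse, ← Equiv.Perm.mul_apply, mul_inv_cancel, Equiv.Perm.one_apply]

theorem wordPerm_reverse_wordPerm (l : List b.support) (i : I) :
    wordPerm b l.reverse (wordPerm b l i) = i := by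
  rw [wordPerm_reverse, ← Equiv.Perm.mul_apply, inv_mul_cancel, Equiv.Perm.one_apply]

theorem root_neg (i : I) : P.root (P.reflectionPerm i i) = -P.root i := by
  simp

theorem root_wordPerm (l : List b.support) (i : I) :
    P.root (wordPerm b l i) = wordEquiv b l (P.root i) := by
  induction l with
  | nil => rfl
  | cons j l ih => simp [ih]

theorem reflectionPerm_mul_self (i : I) : P.reflectionPerm i * P.reflectionPerm i = 1 := by
  rw [← sq, P.reflectionPerm_sq]

theorem reflectionPerm_conj (i j : I) :
    P.reflectionPerm (P.reflectionPerm j i) =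
      P.reflectionPerm j * P.reflectionPerm i * P.reflectionPerm j := by
  ext k
  apply P.root.injective
  simp [P.reflection_reflectionPerm]

theorem reflectionPerm_wordPerm_mul (l : List b.support) (i : I) :
    P.reflectionPerm (wordPerm b l i) * wordPerm b l = wordPerm b l * P.reflectionPerm i := by
  induction l with
  | nil => simp
  | cons j l ih =>
    rw [wordPerm_cons, Equiv.Perm.mul_apply, reflectionPerm_conj, mul_assoc _ (wordPerm b l), ← ih]
    simp only [← mul_assoc]
    rw [mul_assoc _ (P.reflectionPerm j) (P.reflectionPerm j), reflectionPerm_mul_self, mul_one]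

theorem wordPerm_neg (l : List b.support) (i : I) :
    wordPerm b l (P.reflectionPerm i i) =
      P.reflectionPerm (wordPerm b l i) (wordPerm b l i) :=
  (congrArg (· i) (reflectionPerm_wordPerm_mul b l i)).symm

theorem pairing_wordPerm (l : List b.support) (i j : I) :
    P.pairing (wordPerm b l i) (wordPerm b l j) = P.pairing i j := by
  induction l with
  | nil => rfl
  | cons k l ih => simp [P.pairing_reflectionPerm, ih]

theorem height_neg (i : I) : b.height (P.reflectionPerm i i) = -b.height i :=
  b.height_reflectionPerm_self i

theorem isPos_neg_iff (i : I) : b.IsPos (P.reflectionPerm i i) ↔ ¬ b.IsPos i :=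
  RootPairing.Base.IsPos.neg_iff_not b i

variable [Finite I] [P.IsCrystallographic] [P.IsReduced]

/-- The exchange condition. -/
theorem exists_sublist_of_not_isPos (l : List b.support) (j : b.support)
    (h : ¬ b.IsPos (wordPerm b l j)) :
    ∃ m : List b.support, m.Sublist l ∧ m.length < l.length ∧
      wordPerm b m = wordPerm b l * P.reflectionPerm j := by
  induction l with
  | nil => exact absurd (RootPairing.Base.isPos_of_mem_support j.2) h
  | cons i l ih =>
    by_cases hl : b.IsPos (wordPerm b l j)
    -- The simple reflection in `i` makes only one positive root negative, namely `i`. Hence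
    -- conjugating the reflection in `j` by `l` gives the reflection in `i`, and the letter `i` can
    -- be dropped.
    · have hi : wordPerm b l j = i := by
        by_contra hne
        exact h (by simpa using hl.reflectionPerm i.2 hne)
      refine ⟨l, List.sublist_cons_self _ _, by simp, ?_⟩
      rw [wordPerm_cons, ← hi, reflectionPerm_wordPerm_mul, mul_assoc, reflectionPerm_mul_self,
        mul_one]
    · obtain ⟨m, hm, hlen, hp⟩ := ih hl
      refine ⟨i :: m, hm.cons_cons i, by simpa using hlen, ?_⟩
      simp [hp, mul_assoc]

/-- A word in `S` whose permutation keeps the simple roots of `S` positive acts trivially. -/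
theorem wordPerm_eq_one_of_forall_isPos (S : Set b.support) (l : List b.support)
    (hS : ∀ i ∈ l, i ∈ S) (h : ∀ j ∈ S, b.IsPos (wordPerm b l j)) : wordPerm b l = 1 := by
  induction hn : l.length using Nat.strong_induction_on generalizing l with
  | _ n ih =>
    rcases List.eq_nil_or_concat l with rfl | ⟨l', j, rfl⟩
    · rfl
    have hj : j ∈ S := hS j (by simp)
    -- The last letter `j` negates its own root, so positivity for the full word is negativity for
    -- `l'`. Exchange then gives a shorter word with the same permutation.
    have hneg : ¬ b.IsPos (wordPerm b l' j) := by
      have := h j hj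
      simp only [List.concat_eq_append, wordPerm_append, wordPerm_cons, wordPerm_nil, mul_one,
        Equiv.Perm.mul_apply, wordPerm_neg, isPos_neg_iff] at this
      exact this
    obtain ⟨m, hm, hlen, hp⟩ := exists_sublist_of_not_isPos b l' j hneg
    have hp' : wordPerm b m = wordPerm b (l'.concat j) := by simp [hp]
    rw [← hp']
    refine ih m.length (by simp at hn; omega) m (fun i hi => hS i ?_) (by rwa [hp']) rfl
    simp [hm.subset hi]

end Words

/-! ### Coefficients, heights and the opposition on `J` -/

section Opposition

variable {I M N : Type*} [AddCommGroup M] [Module ℝ M] [AddCommGroup N] [Module ℝ N]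
  {P : RootPairing I ℝ M N} (b : P.Base) [P.IsRootSystem]

/-- The coefficient of the simple root `αₖ` in the root with index `i`. -/
def coeff (k : b.support) (i : I) : ℝ := b.toWeightBasis.repr (P.root i) k

theorem coeff_simple_self (k : b.support) : coeff b k k = 1 := by
  simp [coeff]

theorem coeff_simple_of_ne {k j : b.support} (h : j ≠ k) : coeff b k j = 0 := by
  simp [coeff, h]

theorem coeff_neg (k : b.support) (i : I) :
    coeff b k (P.reflectionPerm i i) = -coeff b k i := by
  simp [coeff]

theorem coeff_add (k : b.support) {i j l : I} (h : P.root l = P.root i + P.root j) :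
    coeff b k l = coeff b k i + coeff b k j := by
  simp [coeff, h]

/-- A simple reflection other than that of `α_d` changes a root by a multiple of its own simple
root. -/
theorem coeff_wordPerm (d : b.support) (l : List b.support) (hl : ∀ i ∈ l, i ≠ d) (i : I) :
    coeff b d (wordPerm b l i) = coeff b d i := by
  induction l with
  | nil => rfl
  | cons j l ih =>
    have hj : j ≠ d := hl j (by simp)
    rw [← ih fun i hi => hl i (by simp [hi])]
    simp [coeff, P.reflection_apply, hj]

variable [Finite I] [P.IsCrystallographic]

theorem exists_nat_coeff (k : b.support) {i : I} (hi : b.IsPos i) :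
    ∃ n : ℕ, coeff b k i = n := by
  classical
  refine hi.induction_on_add (p := fun i => ∃ n : ℕ, coeff b k i = n) ?_ ?_
  · intro j hj
    by_cases h : (⟨j, hj⟩ : b.support) = k
    · exact ⟨1, by simpa [← h] using coeff_simple_self b ⟨j, hj⟩⟩
    · exact ⟨0, by simpa using coeff_simple_of_ne b h⟩
  · rintro i j l hl ⟨n, hn⟩ hj
    rw [coeff_add b k hl, hn]
    by_cases h : (⟨j, hj⟩ : b.support) = k
    · exact ⟨n + 1, by simpa [← h] using coeff_simple_self b ⟨j, hj⟩⟩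
    · exact ⟨n, by simpa using coeff_simple_of_ne b h⟩

theorem coeff_nonneg (k : b.support) {i : I} (hi : b.IsPos i) : 0 ≤ coeff b k i := by
  obtain ⟨n, hn⟩ := exists_nat_coeff b k hi
  rw [hn]
  positivity

theorem isPos_of_coeff_pos (k : b.support) {i : I} (hi : 0 < coeff b k i) : b.IsPos i := by
  by_contra h
  have := coeff_nonneg b k ((isPos_neg_iff b i).2 h)
  rw [coeff_neg] at this
  linarith

-- A positive root that is not simple is a positive root plus a simple root, so its height is at
-- least `2`.
omit [P.IsRootSystem] in
theorem mem_support_of_height_eq_one {i : I} (hi : b.height i = 1) : i ∈ b.support := by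
  have hpos : b.IsPos i := by rw [b.isPos_iff, hi]; exact one_pos
  refine (hpos.induction_on_add (p := fun i => 1 ≤ b.height i ∧ (b.height i = 1 → i ∈ b.support))
    (fun i h => ⟨(RootPairing.Base.height_one_of_mem_support h).ge, fun _ => h⟩) ?_).2 hi
  intro i j k hk ih hj
  have := b.height_add hk
  have := RootPairing.Base.height_one_of_mem_support hj
  exact ⟨by omega, by omega⟩

/-- The change of height under a word, for a word that negates the simple roots
other than `α_d`. -/
theorem height_wordPerm_le (d : b.support) (l : List b.support)
    (hneg : ∀ j : b.support, j ≠ d → ¬ b.IsPos (wordPerm b l j)) {i : I} (hi : b.IsPos i) :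
    (coeff b d i = 0 → b.height (wordPerm b l i) ≤ -b.height i) ∧
    (coeff b d i = 1 → b.height (wordPerm b l i) ≤ b.height (wordPerm b l d) + 1 - b.height i) := by
  have hneg' (j : b.support) (h : j ≠ d) : b.height (wordPerm b l j) ≤ -1 := by
    have := hneg j h
    rw [b.isPos_iff'] at this
    omega
  -- Nonnegativity of the coefficient is carried along so that a root obtained by adding `α_d`
  -- cannot have coefficient `0`.
  refine (hi.induction_on_add (p := fun i => 0 ≤ coeff b d i ∧
    ((coeff b d i = 0 → b.height (wordPerm b l i) ≤ -b.height i) ∧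
    (coeff b d i = 1 →
      b.height (wordPerm b l i) ≤ b.height (wordPerm b l d) + 1 - b.height i))) ?_ ?_).2
  · intro j hj
    refine ⟨coeff_nonneg b d (RootPairing.Base.isPos_of_mem_support hj), ?_⟩
    have h1 := RootPairing.Base.height_one_of_mem_support hj
    rw [h1]
    by_cases h : (⟨j, hj⟩ : b.support) = d
    · subst h
      have := coeff_simple_self b ⟨j, hj⟩
      simp_all
    · have := coeff_simple_of_ne b h
      have := hneg' _ h
      simp_all
  · rintro i j k hk ⟨h0, hc0, hc1⟩ hj
    have h1 := RootPairing.Base.height_one_of_mem_support hj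
    have hh := b.height_add hk
    have hw : b.height (wordPerm b l k) = b.height (wordPerm b l i) + b.height (wordPerm b l j) :=
      b.height_add (by simp [root_wordPerm, hk])
    have hc := coeff_add b d hk
    by_cases h : (⟨j, hj⟩ : b.support) = d
    · subst h
      have h2 := coeff_simple_self b ⟨j, hj⟩
      simp only at h2
      rw [h2] at hc
      refine ⟨by linarith, fun h3 => by linarith, fun h3 => ?_⟩
      have := hc0 (by linarith)
      simp only
      omega
    · have h2 := coeff_simple_of_ne b h
      have h4 := hneg' _ h
      simp only at h2 h4
      rw [h2, add_zero] at hc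
      rw [hc]
      refine ⟨h0, fun h3 => ?_, fun h3 => ?_⟩
      · have := hc0 h3
        omega
      · have := hc1 h3
        omega

variable (d : b.support) (l : List b.support) (hl : ∀ i ∈ l, i ≠ d)
  (hneg : ∀ j : b.support, j ≠ d → ¬ b.IsPos (wordPerm b l j))

-- This makes the height bounds available for the inverse. If the inverse kept `α_j` positive, the
-- bound for `l` would give `α_j` negative height.
include hl hneg in
theorem not_isPos_wordPerm_reverse (j : b.support) (hj : j ≠ d) :
    ¬ b.IsPos (wordPerm b l.reverse j) := by
  intro h
  have hc := coeff_wordPerm b d l.reverse (by simpa using hl) j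
  rw [coeff_simple_of_ne b hj] at hc
  have := (height_wordPerm_le b d l hneg h).1 hc
  rw [wordPerm_wordPerm_reverse, RootPairing.Base.height_one_of_mem_support j.2] at this
  rw [b.isPos_iff] at h
  omega

include hl hneg in
/-- The opposition: a word negating the simple roots of `J` maps them to negatives of
simple roots of `J`. -/
theorem exists_wordPerm_simple_eq_neg (j : b.support) (hj : j ≠ d) :
    ∃ k : b.support, k ≠ d ∧ wordPerm b l j = P.reflectionPerm k k := by
  set i := P.reflectionPerm (wordPerm b l j) (wordPerm b l j) with hi
  have hij : wordPerm b l j = P.reflectionPerm i i := by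
    apply P.root.injective
    rw [root_neg, hi, root_neg, neg_neg]
  have hpos : b.IsPos i := (isPos_neg_iff b _).2 (hneg j hj)
  have hc : coeff b d i = 0 := by
    rw [hi, coeff_neg, coeff_wordPerm b d l hl, coeff_simple_of_ne b hj, neg_zero]
  -- The inverse word sends `i`, the negative of the image of `α_j`, to `-α_j`, of height `-1`. The
  -- bound then gives `i` height at most `1`.
  have h := (height_wordPerm_le b d l.reverse (not_isPos_wordPerm_reverse b d l hl hneg) hpos).1 hc
  rw [hi, wordPerm_neg, wordPerm_reverse_wordPerm, ← hi, height_neg,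
    RootPairing.Base.height_one_of_mem_support j.2] at h
  have hmem : i ∈ b.support := by
    apply mem_support_of_height_eq_one
    rw [b.isPos_iff] at hpos
    omega
  refine ⟨⟨i, hmem⟩, ?_, hij⟩
  rintro rfl
  have := coeff_simple_self b ⟨i, hmem⟩
  simp only at this hc
  linarith

-- The square sends simple roots of `J` to positive roots, since two sign changes cancel, and a word
-- in `J` with that property is trivial.
include hl hneg in
theorem wordPerm_mul_self [P.IsReduced] : wordPerm b l * wordPerm b l = 1 := by
  rw [← wordPerm_append]
  refine wordPerm_eq_one_of_forall_isPos b {j | j ≠ d} _ (by simpa using hl) fun j hj => ?_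
  obtain ⟨k, hk, h⟩ := exists_wordPerm_simple_eq_neg b d l hl hneg j hj
  rw [wordPerm_append, Equiv.Perm.mul_apply, h, wordPerm_neg, isPos_neg_iff]
  exact hneg k hk

include hl hneg in
/-- A word negating the simple roots of `J` maps `α_d` to the highest root. -/
theorem wordPerm_eq_of_height_le (t : I) (ht : coeff b d t = 1)
    (hmax : ∀ i, b.height i ≤ b.height t) : wordPerm b l d = t := by
  have hc : coeff b d (wordPerm b l.reverse t) = 1 := by
    rw [coeff_wordPerm b d _ (by simpa using hl), ht]
  have hpos := isPos_of_coeff_pos b d (by rw [hc]; exact one_pos)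
  -- Applied to the preimage of `t`: since the image of `α_d` is no higher than `t`, the preimage
  -- has height at most `1`.
  have h := (height_wordPerm_le b d l hneg hpos).2 hc
  rw [wordPerm_wordPerm_reverse] at h
  have := hmax (wordPerm b l d)
  have hmem : wordPerm b l.reverse t ∈ b.support := by
    apply mem_support_of_height_eq_one
    rw [b.isPos_iff] at hpos
    omega
  have hd : (⟨_, hmem⟩ : b.support) = d := by
    by_contra hne
    have := coeff_simple_of_ne b hne
    simp only at this
    linarith
  rw [← hd]
  exact wordPerm_wordPerm_reverse b l t

end Opposition

/-! ### Existence and maximality of the highest root -/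

section HighestRoot

variable {I M N : Type*} [AddCommGroup M] [Module ℝ M] [AddCommGroup N] [Module ℝ N]
  {P : RootPairing I ℝ M N} (b : P.Base) [P.IsRootSystem] [Finite I] [P.IsCrystallographic]

omit [Finite I] [P.IsCrystallographic] in
theorem pairing_eq_sum_coeff (i j : I) :
    P.pairing i j = ∑ k : b.support, coeff b k i * P.pairing k j := by
  have := congrArg (P.coroot' j) (b.toWeightBasis.sum_repr (P.root i))
  simpa [coeff] using this.symm

omit [P.IsRootSystem] in
theorem pairingIn_nonneg_of_forall_add_notMem {i : I} (hi : b.IsPos i)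
    (h : ∀ j ∈ b.support, P.root i + P.root j ∉ Set.range P.root) {j : I} (hj : j ∈ b.support) :
    0 ≤ P.pairingIn ℤ i j := by
  by_contra! hlt
  refine h j hj (P.root_add_root_mem_of_pairingIn_neg hlt fun heq => ?_)
  rw [P.root_eq_neg_iff] at heq
  rw [heq, isPos_neg_iff] at hi
  exact hi (RootPairing.Base.isPos_of_mem_support hj)

/-- Such a root is dominant. If its support were proper, connectedness of the Dynkin diagram would
give a simple root outside the support but adjacent to it, and the pairing there would be negative.
-/
theorem coeff_pos_of_forall_add_notMem [P.IsReduced] [P.IsIrreducible] {i : I} (hi : b.IsPos i)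
    (h : ∀ j ∈ b.support, P.root i + P.root j ∉ Set.range P.root) (k : b.support) :
    0 < coeff b k i := by
  classical
  obtain ⟨k₀, hk₀⟩ : ∃ k₀, 0 < coeff b k₀ i := by
    by_contra! hle
    have hz (k) : coeff b k i = 0 := le_antisymm (hle k) (coeff_nonneg b k hi)
    have := pairing_eq_sum_coeff b i i
    simp [hz] at this
  refine b.induction_on_cartanMatrix (fun k => 0 < coeff b k i) hk₀ fun k j hk hkj => ?_
  refine (coeff_nonneg b j hi).lt_of_ne' fun hj => ?_
  have hdom := pairingIn_nonneg_of_forall_add_notMem b hi h j.2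
  have hsum := pairing_eq_sum_coeff b i j
  have hterm (m : b.support) : coeff b m i * P.pairing m j ≤ 0 := by
    by_cases hm : m = j
    · simp [hm, hj]
    · refine mul_nonpos_of_nonneg_of_nonpos (coeff_nonneg b m hi) ?_
      rw [← P.algebraMap_pairingIn ℤ]
      simpa using b.pairingIn_le_zero_of_ne (fun e => hm (Subtype.ext e)) m.2 j.2
  have hlt : P.pairing k j ≠ 0 := by
    rwa [ne_eq, b.cartanMatrix_apply_eq_zero_iff_symm,
      b.cartanMatrix_apply_eq_zero_iff_pairing] at hkj
  have hneg : ∑ m : b.support, coeff b m i * P.pairing m j < 0 := by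
    refine Finset.sum_neg' (fun m _ => hterm m) ⟨k, Finset.mem_univ k, ?_⟩
    exact (hterm k).lt_of_ne (mul_ne_zero hk.ne' hlt)
  rw [← hsum, ← P.algebraMap_pairingIn ℤ] at hneg
  simp at hneg
  omega

omit [P.IsRootSystem] in
theorem mem_closure_of_isPos {i : I} (hi : b.IsPos i) :
    P.root i ∈ AddSubmonoid.closure (P.root '' b.support) := by
  refine hi.induction_on_add (p := fun i => P.root i ∈ AddSubmonoid.closure (P.root '' b.support))
    (fun j hj => AddSubmonoid.subset_closure ⟨j, hj, rfl⟩) fun i j k hk h hj => ?_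
  rw [hk]
  exact add_mem h (AddSubmonoid.subset_closure ⟨j, hj, rfl⟩)

/-- A root `t` of maximal height works. For a positive root `i`, induct on the height deficit:
either a simple root can be added to `i`, or `i` has full support and pairs positively with the
dominant root `t`, which makes `i - t` zero or a root. -/
theorem exists_isHighestRoot [Nonempty I] [P.IsReduced] [P.IsIrreducible] :
    ∃ t, IsHighestRoot b t := by
  obtain ⟨t, ht⟩ := Finite.exists_max b.height
  have htpos : b.IsPos t := by
    obtain ⟨j, hj⟩ := b.support_nonempty
    have := ht j
    rw [RootPairing.Base.height_one_of_mem_support hj] at this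
    rw [b.isPos_iff]
    omega
  have httop : ∀ j ∈ b.support, P.root t + P.root j ∉ Set.range P.root := by
    rintro j hj ⟨k, hk⟩
    have := b.height_add hk
    have := RootPairing.Base.height_one_of_mem_support hj
    have := ht k
    omega
  have key (i : I) (hi : b.IsPos i) :
      P.root t - P.root i ∈ AddSubmonoid.closure (P.root '' b.support) := by
    induction hn : (b.height t - b.height i).toNat using Nat.strong_induction_on generalizing i with
    | _ n ih =>
    by_cases htop : ∀ j ∈ b.support, P.root i + P.root j ∉ Set.range P.root
    · by_cases hit : i = t
      · simp [hit]
      have hpair : 0 < P.pairing i t := by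
        rw [pairing_eq_sum_coeff b]
        have hdom (k : b.support) : 0 ≤ P.pairingIn ℤ k t := by
          have h1 := pairingIn_nonneg_of_forall_add_notMem b htpos httop k.2
          have := (P.pairingIn_lt_zero_iff ℤ (i := k) (j := t)).1
          by_contra! h2
          exact absurd (this h2) (by omega)
        obtain ⟨k, hk, hkt⟩ := htpos.exists_mem_support_pos_pairingIn
        refine Finset.sum_pos' (fun m _ => mul_nonneg (coeff_nonneg b m hi) ?_)
          ⟨⟨k, hk⟩, Finset.mem_univ _,
            mul_pos (coeff_pos_of_forall_add_notMem b hi htop _) ?_⟩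
        · rw [← P.algebraMap_pairingIn ℤ]
          simpa using hdom m
        · rw [← P.algebraMap_pairingIn ℤ]
          simpa using hkt
      rw [← P.algebraMap_pairingIn ℤ] at hpair
      obtain ⟨k, hk⟩ := P.root_sub_root_mem_of_pairingIn_pos (by simpa using hpair) hit
      -- `k` is the root `i - t`; its height is at most `0` by the choice of `t`, so `t - i` is a
      -- positive root.
      have hkneg : ¬ b.IsPos k := by
        have := b.height_sub hk
        have := ht i
        rw [b.isPos_iff]
        omega
      have := mem_closure_of_isPos b ((isPos_neg_iff b k).2 hkneg)
      rwa [root_neg, hk, neg_sub] at this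
    · push Not at htop
      obtain ⟨j, hj, k, hk⟩ := htop
      have h1 := b.height_add hk
      have h2 := RootPairing.Base.height_one_of_mem_support hj
      have h3 := ht k
      have hj' : P.root j ∈ AddSubmonoid.closure (P.root '' b.support) :=
        AddSubmonoid.subset_closure ⟨j, hj, rfl⟩
      have := add_mem (ih _ (by omega) k
        (hi.add (RootPairing.Base.isPos_of_mem_support hj) hk) rfl) hj'
      rw [hk] at this
      convert this using 1
      abel
  refine ⟨t, fun i => ?_⟩
  by_cases hi : b.IsPos i
  · exact key i hi
  · have := add_mem (mem_closure_of_isPos b htpos)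
      (mem_closure_of_isPos b ((isPos_neg_iff b i).2 hi))
    simpa [sub_eq_add_neg] using this

theorem isHighestRoot_highestRoot [Nonempty I] [P.IsReduced] [P.IsIrreducible] :
    IsHighestRoot b (highestRoot b) :=
  Classical.epsilon_spec (exists_isHighestRoot b)

omit [Finite I] [P.IsCrystallographic] in
theorem height_eq_sum_coeff (i : I) : (b.height i : ℝ) = ∑ k : b.support, coeff b k i := by
  obtain ⟨f, -, -, hf⟩ := b.exists_root_eq_sum_int i
  have hf' : P.root i = ∑ j : b.support, (f j : ℝ) • b.toWeightBasis j := by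
    rw [hf, ← Finset.sum_coe_sort b.support]
    simp [Int.cast_smul_eq_zsmul]
  rw [RootPairing.Base.height_eq_sum hf, ← Finset.sum_coe_sort b.support, Int.cast_sum]
  refine Finset.sum_congr rfl fun k _ => ?_
  rw [coeff, hf', Module.Basis.repr_sum_self]

theorem IsHighestRoot.height_le {t : I} (h : IsHighestRoot b t) (i : I) :
    b.height i ≤ b.height t := by
  have key : ∀ x ∈ AddSubmonoid.closure (P.root '' b.support),
      0 ≤ ∑ k : b.support, b.toWeightBasis.repr x k := by
    intro x hx
    induction hx using AddSubmonoid.closure_induction with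
    | mem x hx =>
      obtain ⟨j, hj, rfl⟩ := hx
      exact Finset.sum_nonneg fun k _ =>
        coeff_nonneg b k (RootPairing.Base.isPos_of_mem_support hj)
    | zero => simp
    | add x y _ _ hx hy =>
      simp only [map_add, Finsupp.add_apply, Finset.sum_add_distrib]
      exact add_nonneg hx hy
  have := key _ (h i)
  simp only [map_sub, Finsupp.sub_apply, Finset.sum_sub_distrib] at this
  rw [← Int.cast_le (R := ℝ), height_eq_sum_coeff, height_eq_sum_coeff]
  simpa [coeff] using this

end HighestRoot

/-! ### The finite Weyl group acting on `V`, and the longest element of `W_J` -/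

section Affine

variable {I M N : Type*} [AddCommGroup M] [Module ℝ M] [AddCommGroup N] [Module ℝ N]
  {P : RootPairing I ℝ M N} (b : P.Base)

/-- The projection `V → M` along `δ`, which sends `α₀` to `-θ₀`. -/
def proj [Nonempty I] : V b →ₗ[ℝ] M :=
  Finsupp.linearCombination ℝ fun x => P.root (finiteRoot b x)

/-- The embedding `M → V` as the span of `D₀`. -/
def lift [P.IsRootSystem] : M →ₗ[ℝ] V b :=
  b.toWeightBasis.constr ℝ fun i => simpleRoot b (some i)

@[simp] theorem lift_simple [P.IsRootSystem] (i : b.support) :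
    lift b (P.root i) = simpleRoot b (some i) := by
  rw [← b.toWeightBasis_apply, lift, Module.Basis.constr_basis]

@[simp] theorem proj_simpleRoot [Nonempty I] (x : Node b) :
    proj b (simpleRoot b x) = P.root (finiteRoot b x) := by
  simp [proj, simpleRoot]

variable [Nonempty I] [P.IsRootSystem]

@[simp] theorem proj_lift (m : M) : proj b (lift b m) = m := by
  suffices proj b ∘ₗ lift b = LinearMap.id from LinearMap.congr_fun this m
  refine b.toWeightBasis.ext fun i => ?_
  simp [finiteRoot]

theorem lift_injective : Function.Injective (lift b) :=
  Function.LeftInverse.injective (proj_lift b)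

theorem delta_eq : delta b = simpleRoot b none + lift b (P.root (highestRoot b)) := by
  rw [delta, lift, Module.Basis.constr_apply_fintype]
  rfl

theorem simpleRoot_none : simpleRoot b none = delta b - lift b (P.root (highestRoot b)) := by
  rw [delta_eq, add_sub_cancel_right]

theorem proj_delta : proj b (delta b) = 0 := by
  rw [delta_eq, map_add, proj_lift, proj_simpleRoot, finiteRoot, root_neg, neg_add_cancel]

theorem delta_some (d : b.support) : delta b (some d) = coeff b d (highestRoot b) := by
  classical
  rw [delta, Finsupp.add_apply, Finsupp.finsetSum_apply]
  simp [simpleRoot, coeff, Finsupp.single_apply]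

omit [Nonempty I] [P.IsRootSystem] in
theorem V_ext {f g : V b →ₗ[ℝ] V b} (h : ∀ x, f (simpleRoot b x) = g (simpleRoot b x)) : f = g :=
  Finsupp.lhom_ext' fun x => LinearMap.ext_ring (h x)

variable [P.IsCrystallographic]

-- The extended Cartan matrix consists of pairings of finite roots, so the coroots factor through
-- `proj`; in particular they vanish on `δ`.
omit [P.IsRootSystem] in
theorem simpleCoroot_apply (i : Node b) (x : V b) :
    simpleCoroot b i x = P.coroot' (finiteRoot b i) (proj b x) := by
  suffices simpleCoroot b i = P.coroot' (finiteRoot b i) ∘ₗ proj b from LinearMap.congr_fun this x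
  refine Finsupp.lhom_ext' fun j => LinearMap.ext_ring ?_
  have := proj_simpleRoot b j
  rw [simpleRoot] at this
  simp [simpleCoroot, cartan, this, ← P.algebraMap_pairingIn ℤ]

omit [P.IsRootSystem] in
theorem simpleReflection_apply (i : Node b) (x : V b) :
    simpleReflection b i x =
      x - P.coroot' (finiteRoot b i) (proj b x) • simpleRoot b i := by
  rw [simpleReflection, Module.reflection_apply, simpleCoroot_apply]

theorem simpleReflection_delta (i : Node b) : simpleReflection b i (delta b) = delta b := by
  simp [simpleReflection_apply, proj_delta]

theorem simpleReflection_lift (i : b.support) (m : M) :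
    simpleReflection b (some i) (lift b m) = lift b (P.reflection i m) := by
  simp [simpleReflection_apply, P.reflection_apply, finiteRoot]

/-- The automorphism of `V` given by a word in the simple reflections of `D₀`. -/
def wordV (l : List b.support) : V b ≃ₗ[ℝ] V b :=
  (l.map fun i => simpleReflection b (some i)).prod

omit [P.IsRootSystem] in
@[simp] theorem wordV_cons (i : b.support) (l : List b.support) :
    wordV b (i :: l) = simpleReflection b (some i) * wordV b l := by
  simp [wordV]

omit [P.IsRootSystem] in
theorem wordV_append (l m : List b.support) : wordV b (l ++ m) = wordV b l * wordV b m := by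
  simp [wordV]

theorem wordV_delta (l : List b.support) : wordV b l (delta b) = delta b := by
  induction l with
  | nil => rfl
  | cons i l ih => simp [ih, simpleReflection_delta]

theorem wordV_lift_root (l : List b.support) (i : I) :
    wordV b l (lift b (P.root i)) = lift b (P.root (wordPerm b l i)) := by
  induction l with
  | nil => rfl
  | cons j l ih => simp [ih, simpleReflection_lift]

/-- `V` is spanned by `δ`, which every word fixes, and by the lifted finite roots, so the action on
roots determines the action on `V`. -/
theorem wordV_eq_wordV_iff (l m : List b.support) :
    wordV b l = wordV b m ↔ wordPerm b l = wordPerm b m := by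
  refine ⟨fun h => ?_, fun h => ?_⟩
  · ext i
    apply P.root.injective
    apply lift_injective b
    rw [← wordV_lift_root, ← wordV_lift_root, h]
  · apply LinearEquiv.toLinearMap_injective
    refine V_ext b fun x => ?_
    rcases x with _ | i
    · simp [simpleRoot_none, wordV_delta, wordV_lift_root, h]
    · simp only [← lift_simple, LinearEquiv.coe_coe, wordV_lift_root, h]

omit [P.IsRootSystem] in
theorem wordV_reverse (l : List b.support) : wordV b l.reverse = (wordV b l)⁻¹ := by
  induction l with
  | nil => simp [wordV]
  | cons i l ih =>
    rw [List.reverse_cons, wordV_append, ih, wordV_cons b i l, mul_inv_rev]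
    rfl

variable (d : b.support)

omit [P.IsRootSystem] in
theorem mem_weylSubgroup_setJ_iff (w : V b ≃ₗ[ℝ] V b) :
    w ∈ weylSubgroup b (setJ b d) ↔
      ∃ l : List b.support, (∀ i ∈ l, i ≠ d) ∧ wordV b l = w := by
  constructor
  · intro hw
    induction hw using Subgroup.closure_induction with
    | mem x hx =>
      obtain ⟨_, ⟨i, hi, rfl⟩, rfl⟩ := hx
      exact ⟨[i], by simpa using hi, by simp [wordV]⟩
    | one => exact ⟨[], by simp, rfl⟩
    | mul x y _ _ hx hy =>
      obtain ⟨l, hl, rfl⟩ := hx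
      obtain ⟨m, hm, rfl⟩ := hy
      exact ⟨l ++ m, by grind, wordV_append b l m⟩
    | inv x _ hx =>
      obtain ⟨l, hl, rfl⟩ := hx
      exact ⟨l.reverse, by simpa using hl, wordV_reverse b l⟩
  · rintro ⟨l, hl, rfl⟩
    refine Subgroup.list_prod_mem _ fun x hx => ?_
    obtain ⟨i, hi, rfl⟩ := List.mem_map.1 hx
    exact Subgroup.subset_closure ⟨some i, ⟨i, hl i hi, rfl⟩, rfl⟩

omit [P.IsRootSystem] in
theorem length_wordV_le (l : List b.support) (hl : ∀ i ∈ l, i ≠ d) :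
    length b (setJ b d) (wordV b l) ≤ l.length := by
  refine Nat.sInf_le ⟨l.map some, ?_, ?_, by simp⟩
  · intro x hx
    obtain ⟨i, hi, rfl⟩ := List.mem_map.1 hx
    exact ⟨i, hl i hi, rfl⟩
  · simp [wordV, Function.comp_def]

omit [P.IsRootSystem] in
theorem exists_reduced_word {w : V b ≃ₗ[ℝ] V b} (hw : w ∈ weylSubgroup b (setJ b d)) :
    ∃ l : List b.support, (∀ i ∈ l, i ≠ d) ∧ wordV b l = w ∧
      l.length = length b (setJ b d) w := by
  have hne : {n | ∃ l : List (Node b), (∀ i ∈ l, i ∈ setJ b d) ∧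
      (l.map (simpleReflection b)).prod = w ∧ l.length = n}.Nonempty := by
    obtain ⟨l, hl, rfl⟩ := (mem_weylSubgroup_setJ_iff b d w).1 hw
    refine ⟨_, l.map some, ?_, ?_, rfl⟩
    · intro x hx
      obtain ⟨i, hi, rfl⟩ := List.mem_map.1 hx
      exact ⟨i, hl i hi, rfl⟩
    · simp [wordV, Function.comp_def]
  obtain ⟨l, hl, hlw, hlen⟩ := Nat.sInf_mem hne
  obtain ⟨m, rfl⟩ : ∃ m : List b.support, m.map some = l := by
    refine ⟨l.reduceOption, ?_⟩
    clear hlw hlen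
    induction l with
    | nil => rfl
    | cons x l ih =>
      obtain ⟨i, -, rfl⟩ := hl x (by simp)
      simp [ih fun i hi => hl i (by simp [hi])]
  refine ⟨m, fun i hi => ?_, ?_, ?_⟩
  · obtain ⟨j, hj, hij⟩ := hl (some i) (by simpa using hi)
    exact (Option.some.inj hij) ▸ hj
  · simpa [wordV, Function.comp_def] using hlw
  · rw [length, ← hlen, List.length_map]

theorem finite_weylSubgroup_setJ [Finite I] :
    (weylSubgroup b (setJ b d) : Set (V b ≃ₗ[ℝ] V b)).Finite := by
  have hsub : (weylSubgroup b (setJ b d) : Set (V b ≃ₗ[ℝ] V b)) ⊆ Set.range (wordV b) := by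
    intro w hw
    obtain ⟨l, -, rfl⟩ := (mem_weylSubgroup_setJ_iff b d w).1 hw
    exact ⟨l, rfl⟩
  refine Set.Finite.subset ?_ hsub
  refine Finite.of_injective
    (fun w : Set.range (wordV b) => (wordPerm b w.2.choose)) fun w w' h => ?_
  apply Subtype.ext
  rw [← w.2.choose_spec, ← w'.2.choose_spec]
  exact (wordV_eq_wordV_iff b _ _).2 h

theorem isLongest_longest [Finite I] : IsLongest b (setJ b d) (longest b (setJ b d)) := by
  apply Classical.epsilon_spec (p := IsLongest b (setJ b d))
  obtain ⟨w, hw, hmax⟩ := Set.exists_max_image _ (length b (setJ b d))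
    (finite_weylSubgroup_setJ b d) ⟨1, one_mem _⟩
  exact ⟨w, hw, hmax⟩

/-- The longest element of `W_J` negates every simple root of `J`. -/
theorem exists_word_longest [Finite I] [P.IsReduced] :
    ∃ l : List b.support, (∀ i ∈ l, i ≠ d) ∧ wordV b l = longest b (setJ b d) ∧
      ∀ j : b.support, j ≠ d → ¬ b.IsPos (wordPerm b l j) := by
  obtain ⟨hw, hmax⟩ := isLongest_longest b d
  obtain ⟨l, hl, hlw⟩ := (mem_weylSubgroup_setJ_iff b d _).1 hw
  refine ⟨l, hl, hlw, fun j hj hpos => ?_⟩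
  have hlj : ∀ i ∈ l ++ [j], i ≠ d := by grind
  have hmem := (mem_weylSubgroup_setJ_iff b d _).2 ⟨l ++ [j], hlj, rfl⟩
  -- If `α_j` stayed positive, appending `j` would make it negative. Exchange would then shorten a
  -- reduced word of the product to a word for the longest element, contradicting maximal length.
  obtain ⟨m, hm, hmw, hmlen⟩ := exists_reduced_word b d hmem
  have hmp : wordPerm b m = wordPerm b l * P.reflectionPerm j := by
    simpa using (wordV_eq_wordV_iff b _ _).1 hmw
  have hneg : ¬ b.IsPos (wordPerm b m j) := by
    rw [hmp, Equiv.Perm.mul_apply, wordPerm_neg, isPos_neg_iff]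
    exact not_not.2 hpos
  obtain ⟨m', hsub, hlen, hp⟩ := exists_sublist_of_not_isPos b m j hneg
  have hm'w : wordV b m' = longest b (setJ b d) := by
    rw [← hlw, wordV_eq_wordV_iff, hp, hmp, mul_assoc, reflectionPerm_mul_self, mul_one]
  have h1 := length_wordV_le b d m' fun i hi => hm i (hsub.subset hi)
  have h2 := hmax _ hmem
  rw [hm'w] at h1
  omega

end Affine

/-! ### The map `ι` as `-w_J` up to multiples of `δ` -/

section Involution

variable {I M N : Type*} [AddCommGroup M] [Module ℝ M] [AddCommGroup N] [Module ℝ N]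
  {P : RootPairing I ℝ M N} (b : P.Base) [Nonempty I] [P.IsCrystallographic] (d : b.support)

theorem iota_none : iota b d (simpleRoot b none) = simpleRoot b (some d) := by
  simp [iota, simpleRoot]

theorem iota_some_self : iota b d (simpleRoot b (some d)) = simpleRoot b none := by
  simp [iota, simpleRoot]

theorem iota_some_of_ne {i : b.support} (hi : i ≠ d) :
    iota b d (simpleRoot b (some i)) = -(longest b (setJ b d) (simpleRoot b (some i))) := by
  simp [iota, simpleRoot, hi]

variable [P.IsRootSystem]

/-- Every simple reflection fixes `δ`, so its reflection formula forces `δ` to be orthogonal to that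
simple root. -/
theorem IsInvariantForm.delta_right {B : V b →ₗ[ℝ] V b →ₗ[ℝ] ℝ} (hB : IsInvariantForm b B)
    (x : V b) : B x (delta b) = 0 := by
  suffices B.flip (delta b) = 0 from LinearMap.congr_fun this x
  refine Finsupp.lhom_ext' fun i => LinearMap.ext_ring ?_
  have hne : B (simpleRoot b i) (simpleRoot b i) ≠ 0 := by
    -- Division by zero returns zero, so an isotropic `α_i` would be fixed by its own reflection,
    -- which in fact negates it.
    intro h0
    have h := hB.reflection i (simpleRoot b i)
    rw [h0, div_zero, zero_smul, sub_zero, simpleReflection, Module.reflection_apply_self] at h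
    have := congrArg (fun f => f i) h
    simp [simpleRoot] at this
    norm_num at this
  have h := hB.reflection i (delta b)
  rw [simpleReflection_delta, eq_comm, sub_eq_self] at h
  have h2 : 2 * B (simpleRoot b i) (delta b) / B (simpleRoot b i) (simpleRoot b i) = 0 := by
    simpa [simpleRoot] using h
  have h3 : B (simpleRoot b i) (delta b) = 0 := by
    simpa [hne] using h2
  simpa [simpleRoot] using h3

/-- The linear form on `V` with value `1` at `α₀` and `α_d` and `0` at the simple roots of `J`. -/
def levelForm : V b →ₗ[ℝ] ℝ := Finsupp.lapply none + Finsupp.lapply (some d)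

variable [Finite I] [P.IsReduced] [P.IsIrreducible]

variable (hd : IsCominuscule b d) (l : List b.support) (hl : ∀ i ∈ l, i ≠ d)
  (hlw : wordV b l = longest b (setJ b d))
  (hneg : ∀ j : b.support, j ≠ d → ¬ b.IsPos (wordPerm b l j))

include hd hl hneg in
theorem wordPerm_eq_highestRoot : wordPerm b l d = highestRoot b :=
  wordPerm_eq_of_height_le b d l hl hneg _ ((delta_some b d).symm.trans hd)
    ((isHighestRoot_highestRoot b).height_le b)

include hd hl hneg in
theorem wordPerm_highestRoot : wordPerm b l (highestRoot b) = d := by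
  rw [← wordPerm_eq_highestRoot b d hd l hl hneg, ← Equiv.Perm.mul_apply,
    wordPerm_mul_self b d l hl hneg, Equiv.Perm.one_apply]

include hd hl hlw hneg in
theorem iota_apply (x : V b) : iota b d x = levelForm b d x • delta b - wordV b l x := by
  classical
  suffices iota b d = (levelForm b d).smulRight (delta b) - (wordV b l).toLinearMap from
    LinearMap.congr_fun this x
  refine V_ext b fun x => ?_
  rcases x with _ | i
  · rw [iota_none, LinearMap.sub_apply, LinearMap.smulRight_apply, LinearEquiv.coe_coe]
    rw [show levelForm b d (simpleRoot b none) = 1 by simp [levelForm, simpleRoot],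
      simpleRoot_none, map_sub, wordV_delta, wordV_lift_root,
      wordPerm_highestRoot b d hd l hl hneg, lift_simple]
    simp
  · by_cases hi : i = d
    · subst hi
      rw [iota_some_self, LinearMap.sub_apply, LinearMap.smulRight_apply, LinearEquiv.coe_coe,
        show levelForm b i (simpleRoot b (some i)) = 1 by simp [levelForm, simpleRoot],
        ← lift_simple, wordV_lift_root, wordPerm_eq_highestRoot b i hd l hl hneg, simpleRoot_none]
      simp
    · rw [iota_some_of_ne b d hi, LinearMap.sub_apply, LinearMap.smulRight_apply,
        LinearEquiv.coe_coe, hlw,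
        show levelForm b d (simpleRoot b (some i)) = 0 by simp [levelForm, simpleRoot, hi]]
      simp

include hd hl hlw hneg in
/-- The finite root attached to a vertex is sent by `-w_J` to that of another vertex. -/
theorem exists_finiteRoot_eq (x : Node b) :
    ∃ y, iota b d (simpleRoot b x) = simpleRoot b y ∧
      finiteRoot b y =
        P.reflectionPerm (wordPerm b l (finiteRoot b x)) (wordPerm b l (finiteRoot b x)) := by
  simp_rw [← P.root_eq_neg_iff]
  rcases x with _ | i
  · refine ⟨some d, iota_none b d, ?_⟩
    rw [finiteRoot, finiteRoot, wordPerm_neg, wordPerm_highestRoot b d hd l hl hneg, root_neg,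
      neg_neg]
  · by_cases hi : i = d
    · subst hi
      refine ⟨none, iota_some_self b i, ?_⟩
      rw [finiteRoot, finiteRoot, wordPerm_eq_highestRoot b i hd l hl hneg, root_neg]
    · obtain ⟨k, -, hk⟩ := exists_wordPerm_simple_eq_neg b d l hl hneg i hi
      refine ⟨some k, ?_, ?_⟩
      · rw [iota_some_of_ne b d hi, ← hlw, ← lift_simple, wordV_lift_root, hk, root_neg, map_neg,
          neg_neg, lift_simple]
      · rw [finiteRoot, finiteRoot, hk, root_neg, neg_neg]

-- A vertex can thus be recovered from its finite root: `-θ₀` is negative, hence not simple.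
omit [P.IsRootSystem] [P.IsCrystallographic] [P.IsReduced] [P.IsIrreducible] [Finite I] in
theorem finiteRoot_injective_of_isPos (h : b.IsPos (highestRoot b)) :
    Function.Injective (finiteRoot b) := by
  have hne (i : b.support) : finiteRoot b none ≠ finiteRoot b (some i) := by
    intro heq
    have hi := RootPairing.Base.isPos_of_mem_support i.2
    rw [show (i : I) = finiteRoot b (some i) from rfl, ← heq, finiteRoot, isPos_neg_iff] at hi
    exact hi h
  rintro (_ | i) (_ | j) h
  · rfl
  · exact absurd h (hne j)
  · exact absurd h.symm (hne i)
  · exact congrArg some (Subtype.ext h)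

end Involution

end ExtDynkin
end

theorem mainTheorem10 {I M N : Type*} [Finite I] [Nonempty I]
    [AddCommGroup M] [Module ℝ M] [AddCommGroup N] [Module ℝ N]
    (P : RootPairing I ℝ M N) [P.IsRootSystem] [P.IsCrystallographic] [P.IsReduced]
    [P.IsIrreducible] (b : P.Base) (d : b.support) (hd : ExtDynkin.IsCominuscule b d) :
    ExtDynkin.iota b d ∘ₗ ExtDynkin.iota b d = LinearMap.id ∧
    (∃ σ : Equiv.Perm (ExtDynkin.Node b),
      (∀ i, ExtDynkin.iota b d (ExtDynkin.simpleRoot b i) = ExtDynkin.simpleRoot b (σ i)) ∧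
      Function.Involutive σ ∧
      ∀ i j, ExtDynkin.cartan b (σ i) (σ j) = ExtDynkin.cartan b i j) ∧
    (∀ B : ExtDynkin.V b →ₗ[ℝ] ExtDynkin.V b →ₗ[ℝ] ℝ, ExtDynkin.IsInvariantForm b B →
      ∀ x y, B (ExtDynkin.iota b d x) (ExtDynkin.iota b d y) = B x y) := by
  obtain ⟨l, hl, hlw, hneg⟩ := ExtDynkin.exists_word_longest b d
  choose σ hσ hfin using ExtDynkin.exists_finiteRoot_eq b d hd l hl hlw hneg
  have hpos : b.IsPos (ExtDynkin.highestRoot b) := by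
    refine ExtDynkin.isPos_of_coeff_pos b d ?_
    rw [← ExtDynkin.delta_some, hd]
    exact one_pos
  -- On finite roots `σ` acts as `-w_J`, whose square is the identity.
  have hinv : Function.Involutive σ := fun x => by
    apply ExtDynkin.finiteRoot_injective_of_isPos b hpos
    apply P.root.injective
    rw [hfin, ExtDynkin.root_neg, hfin, ExtDynkin.wordPerm_neg, ExtDynkin.root_neg, neg_neg,
      ← Equiv.Perm.mul_apply, ExtDynkin.wordPerm_mul_self b d l hl hneg, Equiv.Perm.one_apply]
  refine ⟨ExtDynkin.V_ext b fun x => ?_, ⟨hinv.toPerm, hσ, hinv, fun i j => ?_⟩,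
    fun B hB x y => ?_⟩
  · rw [LinearMap.comp_apply, hσ, hσ, hinv, LinearMap.id_apply]
  · rw [← Int.cast_inj (α := ℝ)]
    have := ExtDynkin.pairing_wordPerm b l (ExtDynkin.finiteRoot b j) (ExtDynkin.finiteRoot b i)
    simpa [ExtDynkin.cartan, hfin, ← P.algebraMap_pairingIn ℤ] using this
  · have hw : ExtDynkin.wordV b l ∈ ExtDynkin.weylSubgroup b Set.univ :=
      Subgroup.list_prod_mem _ fun g hg => by
        obtain ⟨i, -, rfl⟩ := List.mem_map.1 hg
        exact Subgroup.subset_closure ⟨some i, Set.mem_univ _, rfl⟩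
    -- With `δ` in the radical on both sides, only the two `w_J` terms survive and their signs
    -- cancel.
    have hδ (z) : B (ExtDynkin.delta b) z = 0 := by rw [hB.symm, hB.delta_right]
    rw [ExtDynkin.iota_apply b d hd l hl hlw hneg, ExtDynkin.iota_apply b d hd l hl hlw hneg]
    simp [hδ, hB.delta_right, hB.invariant _ hw]
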